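/- Theorem. For $n\ge 1$ let $\Gamma_n=\langle a_1,\dots,a_n \mid a_1^2a_2^2\cdots a_n^2=1\rangle$ be the fundamental group of the closed non-orientable surface of genus $n$ (the connected sum of $n$ projective planes). For a group $G$ let $\gamma_1(G)=G$ and $\gamma_{i+1}(G)=[\gamma_i(G),G]$. For a finitely generated group $N$, every automorphism $\varphi$ of $N$ induces an automorphism $\varphi_1$ of the torsion-free abelianization of $N$, that is, of the free abelian group $(N/\gamma_2(N))/T$, where $T$ is the torsion subgroup of $N/\gamma_2(N)$; the determinant and the (complex) eigenvalues of $\varphi_1$, with their algebraic multiplicities, are those of an integer matrix representing $\varphi_1$ with respect to a $\mathbb{Z}$-basis. For all integers $c>0$ and $g>1$ there is an automorphism $\varphi$ of $N=\Gamma_{g+1}/\gamma_{c+1}(\Gamma_{g+1})$ such that the induced automorphism $\varphi_1$ of the torsion-free abelianization of $N$ (which, since $c\ge 1$, the projection $\Gamma_{g+1}\to N$ identifies with the torsion-free abelianization of $\Gamma_{g+1}$) has determinant $-1$, has a real eigenvalue of modulus $>1$ which has algebraic multiplicity $1$, and has all its other complex eigenvalues of modulus $<1$. -/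

import Mathlib

/-- The word `a₁² a₂² ⋯ aₙ²` in the free group on `a₁, …, aₙ`. -/
def squareRelator (n : ℕ) : FreeGroup (Fin n) :=
  (List.ofFn fun i : Fin n => FreeGroup.of i ^ 2).prod

/-- The fundamental group `Γₙ = ⟨a₁, …, aₙ | a₁² a₂² ⋯ aₙ² = 1⟩` of the non-orientable closed
surface of genus `n` (the connected sum of `n` projective planes). -/
abbrev NonorientableSurfaceGroup (n : ℕ) : Type :=
  PresentedGroup ({squareRelator n} : Set (FreeGroup (Fin n)))

/-- The quotient `G / γ_{c+1}(G)`, where `γ₁(G) = G` and `γ_{i+1}(G) = [γᵢ(G), G]`.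
Mathlib's lower central series starts at index `0`, so its term of index `c` is `γ_{c+1}(G)`. -/
abbrev NilpotentQuotient (G : Type*) [Group G] (c : ℕ) : Type _ :=
  G ⧸ (⊤ : Subgroup G).lowerCentralSeries c

/-- The torsion-free abelianization of `G`: the abelianization `G / [G, G]`, written additively,
modulo its torsion subgroup. -/
abbrev TorsionFreeAbelianization (G : Type*) [Group G] : Type _ :=
  Additive (Abelianization G) ⧸ Submodule.torsion ℤ (Additive (Abelianization G))

/-- The endomorphism of the abelianization of `G` induced by an endomorphism of `G`. -/
def abelianizationEnd {G : Type*} [Group G] (φ : G →* G) :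
    Additive (Abelianization G) →ₗ[ℤ] Additive (Abelianization G) :=
  (MonoidHom.toAdditive (Abelianization.map φ)).toIntLinearMap

/-- The endomorphism of the torsion-free abelianization of `G` induced by an endomorphism
of `G`. -/
def torsionFreeAbelianizationEnd {G : Type*} [Group G] (φ : G →* G) :
    TorsionFreeAbelianization G →ₗ[ℤ] TorsionFreeAbelianization G :=
  Submodule.mapQ _ _ (abelianizationEnd φ) (by
    intro x hx
    obtain ⟨a, ha⟩ := (Submodule.mem_torsion_iff x).1 hx
    refine (Submodule.mem_torsion_iff _).2 ⟨a, ?_⟩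
    have h := congrArg (abelianizationEnd φ) ha
    rw [Submonoid.smul_def] at h ⊢
    rwa [map_smul, map_zero] at h)

instance presentedGroup_fg {α : Type*} [Finite α] (rels : Set (FreeGroup α)) :
    Group.FG (PresentedGroup rels) :=
  Group.fg_of_surjective (PresentedGroup.mk_surjective rels)

instance additive_abelianization_finite {G : Type*} [Group G] [Group.FG G] :
    Module.Finite ℤ (Additive (Abelianization G)) := by
  have : Group.FG (Abelianization G) :=
    Group.fg_of_surjective (f := Abelianization.of) (QuotientGroup.mk'_surjective _)
  exact Module.Finite.iff_addGroup_fg.2 inferInstance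

/-!
The torsion-free abelianization of `Γ_{g+1}` is `ℤ^{g+1} / (1, …, 1)`, since the relator becomes
twice the sum of the generators. It is not changed by passing to `Γ_{g+1} / γ_{c+1}`, and
automorphisms of `Γ_{g+1}` descend to that quotient, so it is enough to find one automorphism of
the surface group itself with the right action on `ℤ^g`.

Let `p = X ^ g - X ^ (g - 1) - ⋯ - X - 1`. Modulo `2`, its companion matrix is the cyclic
permutation of the `g + 1` generators acting on `ℤ^{g+1} / (1, …, 1)`. Correspondingly,
over `ℤ` the companion matrix is realized by a cyclic permutation of the crosscaps composed with a single crosscap slide;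
this is the automorphism `slide`. The involution `reflection` acts as `-1`, so the companion matrix
and its negative are both realized. The sign `(-1) ^ g` gives determinant `-1`. To read off the
characteristic polynomial, the torsion-free abelianization is identified with
`ℤ[X] / (p.scaleRoots (±1))` in such a way that the automorphism becomes multiplication by the class
of `X` (`exists_linearEquiv_rootFamily`, `exists_automorphism_charpoly`).

The polynomial `p` has a simple real root `r > 1`, and all its other roots lie in the open unit
disc. If `p(z) = 0` then `z ^ g * (2 - z) = 1`. For `‖z‖ ≥ 1` this and the triangle inequality for
`z ^ g = ∑ z ^ k` give `‖2 - z‖ ≤ 2 - ‖z‖`, so `z` is a positive real root, and there is only one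
such root (`norm_lt_one_of_multinacci_root`, `rootMultiplicity_multinacci`).
-/

/-! ### Homomorphisms out of the surface group -/

namespace NonorientableSurfaceGroup

/-- A family in a group `H` whose squares multiply to `1` defines a homomorphism from the surface
group. -/
def lift {n : ℕ} {H : Type*} [Group H] (f : Fin n → H)
    (hf : (List.ofFn fun i => f i ^ 2).prod = 1) : NonorientableSurfaceGroup n →* H :=
  PresentedGroup.toGroup (f := f) (by
    rintro _ rfl
    rw [squareRelator, map_list_prod, List.map_ofFn, ← hf]
    simp [Function.comp_def])

/-- The generator `aᵢ` of the surface group. In Lean the generators are indexed from `0`, while the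
comments write `a₁, …, aₙ` as in the presentation. -/
def gen {n : ℕ} (i : Fin n) : NonorientableSurfaceGroup n := PresentedGroup.of i

@[simp]
theorem lift_gen {n : ℕ} {H : Type*} [Group H] (f : Fin n → H)
    (hf : (List.ofFn fun i => f i ^ 2).prod = 1) (i : Fin n) : lift f hf (gen i) = f i :=
  PresentedGroup.toGroup.of _

theorem prod_gen_sq (n : ℕ) : (List.ofFn fun i : Fin n => gen i ^ 2).prod = 1 := by
  have h := PresentedGroup.one_of_mem (Set.mem_singleton (squareRelator n))
  rw [squareRelator, map_list_prod, List.map_ofFn] at h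
  exact h

theorem closure_range_gen (n : ℕ) : Subgroup.closure (Set.range (gen (n := n))) = ⊤ :=
  PresentedGroup.closure_range_of _

theorem hom_ext {n : ℕ} {H : Type*} [Group H] {f g : NonorientableSurfaceGroup n →* H}
    (h : ∀ i, f (gen i) = g (gen i)) : f = g :=
  PresentedGroup.ext h

/-! ### Two automorphisms of the surface group -/

theorem prod_ofFn_mul_inv_succ {H : Type*} [Group H] {n : ℕ} (v : Fin (n + 1) → H) :
    (List.ofFn fun j : Fin n => v j.castSucc * (v j.succ)⁻¹).prod = v 0 * (v (Fin.last n))⁻¹ := by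
  induction n with
  | zero => simp
  | succ n ih =>
    rw [List.ofFn_succ, List.prod_cons]
    have := ih fun j => v j.succ
    simp only [Fin.succ_castSucc] at this ⊢
    rw [this]
    simp

/-- The partial product `a₁² a₂² ⋯ aₖ²` of the relator. -/
def partialRelator {n : ℕ} (k : Fin (n + 1)) : NonorientableSurfaceGroup n :=
  Fin.partialProd (fun i => gen i ^ 2) k

theorem partialRelator_zero (n : ℕ) : partialRelator (0 : Fin (n + 1)) = 1 :=
  Fin.partialProd_zero _

theorem partialRelator_succ {n : ℕ} (i : Fin n) :
    partialRelator i.succ = partialRelator i.castSucc * gen i ^ 2 :=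
  Fin.partialProd_succ _ i

theorem partialRelator_last (n : ℕ) : partialRelator (Fin.last n) = 1 := by
  rw [← prod_gen_sq n, partialRelator, Fin.partialProd, List.take_of_length_le (by simp)]

/-- The square of the image of `aᵢ` under `reflectionHom` is `vᵢ₋₁ vᵢ⁻¹`, so that the product of
these squares telescopes. -/
theorem reflection_gen_sq {n : ℕ} (i : Fin n) :
    (partialRelator i.succ * (gen i)⁻¹ * (partialRelator i.succ)⁻¹) ^ 2 =
      partialRelator i.castSucc * (partialRelator i.succ)⁻¹ := by
  rw [conj_pow, inv_pow, partialRelator_succ]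
  group

/-- The endomorphism `aᵢ ↦ vᵢ aᵢ⁻¹ vᵢ⁻¹` with `vᵢ = a₁² ⋯ aᵢ²`. It acts as `-1` on the
abelianization. -/
def reflectionHom (n : ℕ) : NonorientableSurfaceGroup n →* NonorientableSurfaceGroup n :=
  lift (fun i => partialRelator i.succ * (gen i)⁻¹ * (partialRelator i.succ)⁻¹) (by
    simp only [reflection_gen_sq]
    rw [prod_ofFn_mul_inv_succ partialRelator, partialRelator_zero, partialRelator_last]
    simp)

theorem reflectionHom_gen {n : ℕ} (i : Fin n) : reflectionHom n (gen i) =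
    partialRelator i.succ * (gen i)⁻¹ * (partialRelator i.succ)⁻¹ :=
  lift_gen _ _ i

theorem reflectionHom_partialRelator {n : ℕ} (k : Fin (n + 1)) :
    reflectionHom n (partialRelator k) = (partialRelator k)⁻¹ := by
  induction k using Fin.induction with
  | zero => simp [partialRelator_zero]
  | succ i ih =>
    rw [partialRelator_succ, map_mul, ih, map_pow, reflectionHom_gen, reflection_gen_sq,
      partialRelator_succ]
    group

theorem reflectionHom_comp_self (n : ℕ) :
    (reflectionHom n).comp (reflectionHom n) = MonoidHom.id _ := by
  refine hom_ext fun i => ?_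
  simp only [MonoidHom.comp_apply, reflectionHom_gen, map_mul, map_inv,
    reflectionHom_partialRelator, MonoidHom.id_apply]
  group

/-- The involution `reflectionHom` as an automorphism. -/
def reflection (n : ℕ) : NonorientableSurfaceGroup n ≃* NonorientableSurfaceGroup n :=
  MonoidHom.toMulEquiv (reflectionHom n) (reflectionHom n) (reflectionHom_comp_self n)
    (reflectionHom_comp_self n)

/-- The relator, split as `a₁² (a₂² ⋯ aₙ₋₁²) aₙ²`. -/
theorem gen_zero_sq_mul_prod_mul_gen_last_sq (m : ℕ) :
    gen (0 : Fin (m + 2)) ^ 2 * (List.ofFn fun i : Fin m => gen i.succ.castSucc ^ 2).prod *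
      gen (Fin.last (m + 1)) ^ 2 = 1 := by
  have h := prod_gen_sq (m + 2)
  rw [List.ofFn_succ, List.prod_cons, List.ofFn_succ', List.prod_concat] at h
  simpa only [mul_assoc, Fin.succ_castSucc, Fin.succ_last] using h

/-- The relator, split as `a₁² a₂² (a₃² ⋯ aₙ²)`. -/
theorem gen_zero_sq_mul_gen_one_sq_mul_prod (m : ℕ) :
    gen (0 : Fin (m + 2)) ^ 2 * gen (1 : Fin (m + 2)) ^ 2 *
      (List.ofFn fun i : Fin m => gen i.succ.succ ^ 2).prod = 1 := by
  have h := prod_gen_sq (m + 2)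
  rw [List.ofFn_succ, List.prod_cons, List.ofFn_succ, List.prod_cons] at h
  simpa only [mul_assoc, Fin.succ_zero_eq_one] using h

/-- With `x = aₙ` and `y = a₁`, the endomorphism `a₁ ↦ x² y² x⁻¹`, `a₂ ↦ x y⁻¹ x⁻¹`,
`aᵢ ↦ aᵢ₋₁` for `i ≥ 3`. Geometrically it is a cyclic shift of the crosscaps followed by a crosscap
slide. -/
def slideHom (m : ℕ) : NonorientableSurfaceGroup (m + 2) →* NonorientableSurfaceGroup (m + 2) :=
  lift (Fin.cons (gen (Fin.last (m + 1)) ^ 2 * gen 0 ^ 2 * (gen (Fin.last (m + 1)))⁻¹)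
    (Fin.cons (gen (Fin.last (m + 1)) * (gen 0)⁻¹ * (gen (Fin.last (m + 1)))⁻¹)
      fun i : Fin m => gen i.succ.castSucc)) (by
    have h := gen_zero_sq_mul_prod_mul_gen_last_sq m
    rw [List.ofFn_succ, List.prod_cons, List.ofFn_succ, List.prod_cons]
    simp only [Fin.cons_zero, Fin.cons_succ]
    generalize (List.ofFn fun i : Fin m => gen i.succ.castSucc ^ 2).prod = w at h ⊢
    rw [mul_assoc] at h
    generalize gen (Fin.last (m + 1)) = x at h ⊢
    generalize gen (0 : Fin (m + 2)) = y at h ⊢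
    calc
      _ = x ^ 2 * (y ^ 2 * (w * x ^ 2)) * (x ^ 2)⁻¹ := by
        simp only [pow_two]; group
      _ = 1 := by rw [h]; group)

theorem slideHom_gen_zero (m : ℕ) : slideHom m (gen 0) =
    gen (Fin.last (m + 1)) ^ 2 * gen 0 ^ 2 * (gen (Fin.last (m + 1)))⁻¹ :=
  lift_gen _ _ _

theorem slideHom_gen_one (m : ℕ) : slideHom m (gen 1) =
    gen (Fin.last (m + 1)) * (gen 0)⁻¹ * (gen (Fin.last (m + 1)))⁻¹ :=
  lift_gen _ _ _

theorem slideHom_gen_succ_succ {m : ℕ} (i : Fin m) :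
    slideHom m (gen i.succ.succ) = gen i.succ.castSucc :=
  lift_gen _ _ _

/-- The inverse of `slideHom`: with `z = a₁ a₂²`, it sends `a₁ ↦ z⁻¹ a₂⁻¹ z`, `aₙ ↦ z` and
`aᵢ ↦ aᵢ₊₁` otherwise. -/
def slideInvHom (m : ℕ) :
    NonorientableSurfaceGroup (m + 2) →* NonorientableSurfaceGroup (m + 2) :=
  lift (Fin.cons ((gen 0 * gen 1 ^ 2)⁻¹ * (gen 1)⁻¹ * (gen 0 * gen 1 ^ 2))
    (Fin.snoc (α := fun _ => NonorientableSurfaceGroup (m + 2))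
      (fun i : Fin m => gen i.succ.succ) (gen 0 * gen 1 ^ 2))) (by
    have h := gen_zero_sq_mul_gen_one_sq_mul_prod m
    rw [List.ofFn_succ, List.prod_cons, List.ofFn_succ', List.prod_concat]
    simp only [Fin.cons_zero, Fin.cons_succ, Fin.snoc_castSucc, Fin.snoc_last]
    generalize (List.ofFn fun i : Fin m => gen i.succ.succ ^ 2).prod = w at h ⊢
    generalize gen (0 : Fin (m + 2)) = x at h ⊢
    generalize gen (1 : Fin (m + 2)) = y at h ⊢
    calc
      _ = ((x * y ^ 2) ^ 2)⁻¹ * (x ^ 2 * y ^ 2 * w) * (x * y ^ 2) ^ 2 := by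
        simp only [pow_two]; group
      _ = 1 := by rw [h]; group)

theorem slideInvHom_gen_zero (m : ℕ) : slideInvHom m (gen 0) =
    (gen 0 * gen 1 ^ 2)⁻¹ * (gen 1)⁻¹ * (gen 0 * gen 1 ^ 2) :=
  lift_gen _ _ _

theorem slideInvHom_gen_last (m : ℕ) :
    slideInvHom m (gen (Fin.last (m + 1))) = gen 0 * gen 1 ^ 2 := by
  rw [slideInvHom, lift_gen, ← Fin.succ_last, Fin.cons_succ, Fin.snoc_last]

theorem slideInvHom_gen_succ_castSucc {m : ℕ} (i : Fin m) :
    slideInvHom m (gen i.succ.castSucc) = gen i.succ.succ := by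
  rw [slideInvHom, lift_gen, ← Fin.succ_castSucc, Fin.cons_succ, Fin.snoc_castSucc]

theorem slideInvHom_comp_slideHom (m : ℕ) :
    (slideInvHom m).comp (slideHom m) = MonoidHom.id _ := by
  refine hom_ext fun i => ?_
  simp only [MonoidHom.comp_apply, MonoidHom.id_apply]
  cases i using Fin.cases with
  | zero =>
    simp only [slideHom_gen_zero, map_mul, map_pow, map_inv, slideInvHom_gen_zero,
      slideInvHom_gen_last]
    simp only [pow_two]; group
  | succ i =>
    cases i using Fin.cases with
    | zero =>
      simp only [Fin.succ_zero_eq_one, slideHom_gen_one, map_mul, map_inv, slideInvHom_gen_zero,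
        slideInvHom_gen_last]
      simp only [pow_two]; group
    | succ i => rw [slideHom_gen_succ_succ, slideInvHom_gen_succ_castSucc]

theorem slideHom_comp_slideInvHom (m : ℕ) :
    (slideHom m).comp (slideInvHom m) = MonoidHom.id _ := by
  refine hom_ext fun i => ?_
  simp only [MonoidHom.comp_apply, MonoidHom.id_apply]
  cases i using Fin.cases with
  | zero =>
    simp only [slideInvHom_gen_zero, map_mul, map_pow, map_inv, slideHom_gen_zero,
      slideHom_gen_one]
    simp only [pow_two]; group
  | succ i =>
    cases i using Fin.lastCases with
    | last =>
      simp only [Fin.succ_last, slideInvHom_gen_last, map_mul, map_pow, slideHom_gen_zero,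
        slideHom_gen_one]
      simp only [pow_two]; group
    | cast i => rw [Fin.succ_castSucc, slideInvHom_gen_succ_castSucc, slideHom_gen_succ_succ]

/-- The automorphism of the surface group given by `slideHom`. -/
def slide (m : ℕ) : NonorientableSurfaceGroup (m + 2) ≃* NonorientableSurfaceGroup (m + 2) :=
  MonoidHom.toMulEquiv (slideHom m) (slideInvHom m) (slideInvHom_comp_slideHom m)
    (slideHom_comp_slideInvHom m)

end NonorientableSurfaceGroup

section Multinacci

open Polynomial

/-! ### The multinacci polynomial -/

/-- The polynomial `X ^ g - X ^ (g - 1) - ⋯ - X - 1`. -/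
noncomputable def multinacci (g : ℕ) : ℤ[X] := X ^ g - ∑ k ∈ Finset.range g, X ^ k

theorem degree_sum_X_pow_lt (g : ℕ) :
    (∑ k ∈ Finset.range g, (X : ℤ[X]) ^ k).degree < g :=
  (degree_lt_iff_coeff_zero _ _).2 fun k hk => by
    simp only [finsetSum_coeff, coeff_X_pow]
    exact Finset.sum_eq_zero fun i hi => if_neg (by have := Finset.mem_range.1 hi; lia)

theorem monic_multinacci (g : ℕ) : (multinacci g).Monic :=
  monic_X_pow_sub (degree_sum_X_pow_lt g)

theorem natDegree_multinacci (g : ℕ) : (multinacci g).natDegree = g := by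
  refine natDegree_eq_of_degree_eq_some ?_
  rw [multinacci, degree_sub_eq_left_of_degree_lt] <;> rw [degree_X_pow]
  exact degree_sum_X_pow_lt g

theorem coeff_zero_multinacci {g : ℕ} (hg : g ≠ 0) : (multinacci g).coeff 0 = -1 := by
  obtain ⟨m, rfl⟩ := Nat.exists_eq_succ_of_ne_zero hg
  simp [multinacci, Finset.sum_range_succ', coeff_X_pow]

theorem aeval_multinacci {A : Type*} [CommRing A] [Algebra ℤ A] (g : ℕ) (x : A) :
    aeval x (multinacci g) = x ^ g - ∑ k ∈ Finset.range g, x ^ k := by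
  simp [multinacci]

/-- A root of the multinacci polynomial satisfies `x ^ g * (2 - x) = 1`. -/
theorem pow_mul_two_sub_eq_one {A : Type*} [CommRing A] {g : ℕ} {x : A}
    (hx : x ^ g = ∑ k ∈ Finset.range g, x ^ k) : x ^ g * (2 - x) = 1 := by
  have h := geom_sum_mul x g
  rw [← hx] at h
  linear_combination -h

theorem exists_multinacci_root {g : ℕ} (hg : 1 < g) :
    ∃ r : ℝ, 1 < r ∧ r ^ g = ∑ k ∈ Finset.range g, r ^ k := by
  have hcont : ContinuousOn (fun x : ℝ => x ^ g - ∑ k ∈ Finset.range g, x ^ k)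
      (Set.Icc 1 2) := by fun_prop
  have h2 : (2 : ℝ) ^ g - ∑ k ∈ Finset.range g, (2 : ℝ) ^ k = 1 := by
    have := geom_sum_mul (2 : ℝ) g
    linarith
  have h1 : (1 : ℝ) ^ g - ∑ k ∈ Finset.range g, (1 : ℝ) ^ k < 0 := by
    have : (1 : ℝ) < g := by exact_mod_cast hg
    simp; linarith
  obtain ⟨r, hr, h0⟩ := intermediate_value_Icc (by norm_num) hcont
    (show (0 : ℝ) ∈ Set.Icc _ _ from ⟨h1.le, by rw [h2]; norm_num⟩)
  refine ⟨r, lt_of_le_of_ne hr.1 ?_, sub_eq_zero.1 h0⟩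
  rintro rfl
  exact h1.ne h0

/-- The multinacci polynomial has at most one positive real root. -/
theorem not_lt_of_multinacci_roots {g : ℕ} {s t : ℝ} (hs : 0 < s) (hst : s < t)
    (hs' : s ^ g = ∑ k ∈ Finset.range g, s ^ k) (ht' : t ^ g = ∑ k ∈ Finset.range g, t ^ k) :
    False := by
  have hg : g ≠ 0 := by
    rintro rfl
    simp at hs'
  have ht := hs.trans hst
  have : ∑ k ∈ Finset.range g, t ^ k * s ^ g < ∑ k ∈ Finset.range g, s ^ k * t ^ g := by
    refine Finset.sum_lt_sum_of_nonempty (by simpa using hg) fun k hk => ?_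
    obtain ⟨d, rfl⟩ := Nat.exists_eq_add_of_lt (Finset.mem_range.1 hk)
    have h : s ^ (d + 1) < t ^ (d + 1) := pow_lt_pow_left₀ hst hs.le (by simp)
    have := mul_lt_mul_of_pos_left h (show 0 < s ^ k * t ^ k by positivity)
    calc t ^ k * s ^ (k + d + 1) = s ^ k * t ^ k * s ^ (d + 1) := by ring
      _ < s ^ k * t ^ k * t ^ (d + 1) := this
      _ = s ^ k * t ^ (k + d + 1) := by ring
  rw [← Finset.sum_mul, ← Finset.sum_mul, ← hs', ← ht', mul_comm] at this
  exact this.false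

/-- If `‖2 - z‖ ≤ 2 - ‖z‖`, then `z` lies on the segment from `0` to `2`. -/
theorem eq_norm_of_norm_two_sub_le {z : ℂ} (hz : ‖2 - z‖ ≤ 2 - ‖z‖) : z = (‖z‖ : ℂ) := by
  have h1 : (2 - z).re ≤ ‖2 - z‖ := Complex.re_le_norm _
  have h2 : z.re = ‖z‖ := by
    refine le_antisymm (Complex.re_le_norm z) ?_
    simp at h1
    linarith
  have h3 : z.im = 0 := Complex.abs_re_eq_norm.1 (by rw [h2, abs_norm])
  exact Complex.ext (by simp [h2]) (by simp [h3])

/-- All roots except the dominant one lie in the open unit disc. If `t = ‖z‖ ≥ 1`, the triangle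
inequality gives `t ^ g ≤ ∑ t ^ k`, that is `1 ≤ t ^ g * (2 - t)`, while `t ^ g * ‖2 - z‖ = 1`;
hence `‖2 - z‖ ≤ 2 - t`, which makes `z` a positive real root. -/
theorem norm_lt_one_of_multinacci_root {g : ℕ} {r : ℝ} (hr : 1 < r)
    (hr' : r ^ g = ∑ k ∈ Finset.range g, r ^ k) {z : ℂ}
    (hz : z ^ g = ∑ k ∈ Finset.range g, z ^ k) (hne : z ≠ r) : ‖z‖ < 1 := by
  by_contra! h1
  have hA : ‖z‖ ^ g ≤ ∑ k ∈ Finset.range g, ‖z‖ ^ k := by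
    rw [← norm_pow, hz]
    exact (norm_sum_le _ _).trans_eq (by simp)
  have hB : ‖z‖ ^ g * ‖2 - z‖ = 1 := by
    rw [← norm_pow, ← norm_mul, pow_mul_two_sub_eq_one hz, norm_one]
  have hpos : 0 < ‖z‖ ^ g := by positivity
  -- Multiplying `hA` by `‖z‖ - 1 ≥ 0` turns it into `1 ≤ ‖z‖ ^ g * (2 - ‖z‖)`.
  have hC : 1 ≤ ‖z‖ ^ g * (2 - ‖z‖) := by
    have := mul_le_mul_of_nonneg_right hA (sub_nonneg.2 h1)
    rw [geom_sum_mul] at this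
    linarith
  have hreal := eq_norm_of_norm_two_sub_le (le_of_mul_le_mul_left (hB.trans_le hC) hpos)
  have ht : ‖z‖ ^ g = ∑ k ∈ Finset.range g, ‖z‖ ^ k := by
    rw [hreal] at hz
    exact_mod_cast hz
  rcases lt_trichotomy ‖z‖ r with h | h | h
  · exact not_lt_of_multinacci_roots (by linarith) h ht hr'
  · exact hne (hreal.trans (by rw [h]))
  · exact not_lt_of_multinacci_roots (by linarith) h hr' ht

/-- The dominant root is simple: `r * p'(r) = ∑ (g - k) * r ^ k > 0`. -/
theorem rootMultiplicity_multinacci {g : ℕ} (hg : g ≠ 0) {r : ℝ} (hr : 0 < r)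
    (hr' : r ^ g = ∑ k ∈ Finset.range g, r ^ k) :
    ((multinacci g).map (Int.castRingHom ℂ)).rootMultiplicity (r : ℂ) = 1 := by
  have h0 : (multinacci g).map (Int.castRingHom ℂ) ≠ 0 := ((monic_multinacci g).map _).ne_zero
  have hroot : ((multinacci g).map (Int.castRingHom ℂ)).IsRoot (r : ℂ) := by
    simp only [multinacci, IsRoot, Polynomial.map_sub, Polynomial.map_pow, map_X,
      Polynomial.map_sum, eval_sub, eval_pow, eval_X, eval_finsetSum]
    rw [sub_eq_zero]
    exact_mod_cast hr'
  refine le_antisymm ?_ ((rootMultiplicity_pos h0).2 hroot)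
  by_contra! h
  have hd := (one_lt_rootMultiplicity_iff_isRoot h0).1 h |>.2
  simp only [multinacci, IsRoot, Polynomial.map_sub, Polynomial.map_pow, map_X,
    Polynomial.map_sum, derivative_sub, derivative_sum, derivative_X_pow, eval_sub, eval_mul,
    eval_C, eval_pow, eval_X, eval_finsetSum] at hd
  have hd' : (g : ℝ) * r ^ (g - 1) - ∑ k ∈ Finset.range g, (k : ℝ) * r ^ (k - 1) = 0 := by
    exact_mod_cast hd
  have hk : ∀ k : ℕ, r * ((k : ℝ) * r ^ (k - 1)) = k * r ^ k := by
    rintro (_ | k)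
    · simp
    · simp [pow_succ]; ring
  have hsum : ∑ k ∈ Finset.range g, ((g : ℝ) - k) * r ^ k = 0 := by
    have := congrArg (r * ·) hd'
    simp only [mul_sub, hk, Finset.mul_sum, mul_zero] at this
    rw [hr', Finset.mul_sum, ← Finset.sum_sub_distrib] at this
    simpa only [sub_mul] using this
  refine (Finset.sum_pos (fun k hk => ?_) (by simpa using hg)).ne' hsum
  have : (k : ℝ) < g := by exact_mod_cast Finset.mem_range.1 hk
  have := sub_pos.2 this
  positivity

/-- The characteristic polynomial of multiplication by the root in `R[X] / (f)` is `f`. -/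
theorem charpoly_lmul_root {R : Type*} [CommRing R] [Nontrivial R] {f : R[X]} (hf : f.Monic)
    [Module.Free R (AdjoinRoot f)] [Module.Finite R (AdjoinRoot f)] :
    (Algebra.lmul R (AdjoinRoot f) (AdjoinRoot.root f)).charpoly = f := by
  refine (eq_of_monic_of_dvd_of_natDegree_le hf (LinearMap.charpoly_monic _) ?_ ?_)
  · rw [← AdjoinRoot.mk_eq_zero, ← AdjoinRoot.aeval_eq]
    exact Algebra.aeval_self_charpoly_lmul _
  · rw [LinearMap.charpoly_natDegree, (AdjoinRoot.powerBasis' hf).finrank,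
      AdjoinRoot.powerBasis'_dim]

theorem neg_one_pow_mul_coeff_zero_scaleRoots_multinacci {g : ℕ} (hg : g ≠ 0) :
    (-1) ^ g * ((multinacci g).scaleRoots ((-1) ^ g)).coeff 0 = -1 := by
  rw [coeff_scaleRoots, natDegree_multinacci, coeff_zero_multinacci hg, Nat.sub_zero]
  rcases neg_one_pow_eq_or ℤ g with h | h <;> simp [h]

/-- The multinacci polynomial, and likewise the polynomial with the opposite roots, has a simple
real root outside the closed unit disc and all its other roots in the open unit disc. -/
theorem exists_dominant_root_scaleRoots_multinacci {g : ℕ} (hg : 1 < g) (k : ℕ) :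
    ∃ r : ℝ, 1 < |r| ∧
      ((((multinacci g).scaleRoots ((-1) ^ k)).map (Int.castRingHom ℂ)).rootMultiplicity
        (r : ℂ) = 1 ∧
      ∀ z : ℂ, (((multinacci g).scaleRoots ((-1) ^ k)).map (Int.castRingHom ℂ)).IsRoot z →
        z ≠ (r : ℂ) → ‖z‖ < 1) := by
  obtain ⟨r, hr1, hr⟩ := exists_multinacci_root hg
  have hmap : ((multinacci g).scaleRoots ((-1) ^ k)).map (Int.castRingHom ℂ) =
      ((multinacci g).map (Int.castRingHom ℂ)).scaleRoots ((-1) ^ k) := by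
    rw [map_scaleRoots _ _ _ (by simp [(monic_multinacci g).leadingCoeff]),
      map_pow, map_neg, map_one]
  have hs0 : ((-1 : ℂ) ^ k) ≠ 0 := by simp
  refine ⟨(-1) ^ k * r, ?_, ?_, fun z hz hne => ?_⟩
  · rw [abs_mul, abs_pow, abs_neg, abs_one, one_pow, one_mul]
    exact hr1.trans_le (le_abs_self r)
  · rw [hmap]
    push_cast
    rw [rootMultiplicity_scaleRoots _ (IsRegular.of_ne_zero hs0).left]
    exact rootMultiplicity_multinacci (by lia) (by linarith) hr
  · obtain ⟨w, rfl⟩ : ∃ w, z = (-1) ^ k * w := ⟨((-1) ^ k)⁻¹ * z, by field_simp⟩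
    rw [hmap, IsRoot, scaleRoots_eval_mul, mul_eq_zero] at hz
    have h0 := hz.resolve_left (pow_ne_zero _ hs0)
    rw [eval_map] at h0
    change aeval w (multinacci g) = 0 at h0
    rw [aeval_multinacci, sub_eq_zero] at h0
    rw [norm_mul, norm_pow, norm_neg, norm_one, one_pow, one_mul]
    refine norm_lt_one_of_multinacci_root hr1 hr h0 fun h => hne ?_
    rw [h]
    push_cast
    rfl

end Multinacci

/-! ### Torsion-free abelianizations -/

/-- The canonical map from a group to its torsion-free abelianization. -/
def torsionFreeClass (G : Type*) [Group G] : Additive G →+ TorsionFreeAbelianization G :=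
  (Submodule.mkQ (Submodule.torsion ℤ (Additive (Abelianization G)))).toAddMonoidHom.comp
    (MonoidHom.toAdditive Abelianization.of)

/-- The map from the torsion-free abelianization of `G` to a torsion-free `ℤ`-module `M` induced by
a homomorphism from `G` to `M`. -/
def torsionFreeLift {G M : Type*} [Group G] [AddCommGroup M] [Module.IsTorsionFree ℤ M]
    (f : G →* Multiplicative M) : TorsionFreeAbelianization G →ₗ[ℤ] M :=
  Submodule.liftQ _ (AddMonoidHom.toIntLinearMap
    (MonoidHom.toAdditiveLeft (Abelianization.lift f))) (by
      intro x hx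
      obtain ⟨a, ha⟩ := (Submodule.mem_torsion_iff x).1 hx
      rw [Submonoid.smul_def] at ha
      have h := congrArg (AddMonoidHom.toIntLinearMap
        (MonoidHom.toAdditiveLeft (Abelianization.lift f))) ha
      rw [map_smul, map_zero] at h
      exact (smul_eq_zero.1 h).resolve_left (nonZeroDivisors.coe_ne_zero a))

theorem torsionFreeAbelianization_hom_ext {G M : Type*} [Group G] [AddCommGroup M] {S : Set G}
    (hS : Subgroup.closure S = ⊤) {f g : TorsionFreeAbelianization G →ₗ[ℤ] M}
    (h : ∀ x ∈ S, f (torsionFreeClass G (Additive.ofMul x)) =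
      g (torsionFreeClass G (Additive.ofMul x))) : f = g := by
  have key : AddMonoidHom.toMultiplicativeRight (f.toAddMonoidHom.comp (torsionFreeClass G)) =
      AddMonoidHom.toMultiplicativeRight (g.toAddMonoidHom.comp (torsionFreeClass G)) :=
    MonoidHom.eq_of_eqOn_dense hS fun x hx => congrArg Multiplicative.ofAdd (h x hx)
  refine LinearMap.ext fun x => ?_
  obtain ⟨x, rfl⟩ := Submodule.mkQ_surjective _ x
  obtain ⟨x, rfl⟩ := QuotientGroup.mk_surjective (s := commutator G) x
  exact congrArg Multiplicative.toAdd (DFunLike.congr_fun key x)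

/-! ### Nilpotent quotients -/

/-- A homomorphism to a commutative group factors through every nilpotent quotient of positive
class. -/
def nilpotentQuotientLift {G A : Type*} [Group G] [CommGroup A] {c : ℕ} (hc : 0 < c) (f : G →* A) :
    NilpotentQuotient G c →* A :=
  QuotientGroup.lift _ f fun _ hx => MonoidHom.mem_ker.1 <|
    Abelianization.commutator_subset_ker f (Subgroup.lowerCentralSeries_antitone ⊤ hc hx)

/-- The automorphism induced on a nilpotent quotient. -/
def nilpotentQuotientCongr {G : Type*} [Group G] (c : ℕ) (φ : G ≃* G) :
    NilpotentQuotient G c ≃* NilpotentQuotient G c :=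
  QuotientGroup.congr _ _ φ (Subgroup.characteristic_iff_map_eq.1 inferInstance φ)

namespace NonorientableSurfaceGroup

open Polynomial

/-- The class in the torsion-free abelianization of the nilpotent quotient of an element of the
surface group. -/
def nilpotentClass (c n : ℕ) : Additive (NonorientableSurfaceGroup n) →+
    TorsionFreeAbelianization (NilpotentQuotient (NonorientableSurfaceGroup n) c) :=
  (torsionFreeClass _).comp (MonoidHom.toAdditive (QuotientGroup.mk' _))

/-- The class of the generator `aᵢ`. -/
def genClass (c : ℕ) {n : ℕ} (i : Fin n) :
    TorsionFreeAbelianization (NilpotentQuotient (NonorientableSurfaceGroup n) c) :=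
  nilpotentClass c n (Additive.ofMul (gen i))

theorem closure_range_mk_gen (c n : ℕ) :
    Subgroup.closure (Set.range fun i : Fin n =>
      (QuotientGroup.mk (gen i) : NilpotentQuotient (NonorientableSurfaceGroup n) c)) = ⊤ := by
  have h := congrArg (Subgroup.map (QuotientGroup.mk'
    ((⊤ : Subgroup (NonorientableSurfaceGroup n)).lowerCentralSeries c))) (closure_range_gen n)
  rw [MonoidHom.map_closure, ← Set.range_comp, ← MonoidHom.range_eq_map,
    QuotientGroup.range_mk'] at h
  exact h

/-- The classes of the generators sum to zero: twice the sum is the class of the relator. -/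
theorem sum_genClass (c n : ℕ) : ∑ i : Fin n, genClass c i = 0 := by
  let q := AddMonoidHom.toMultiplicativeRight (nilpotentClass c n)
  have h := congrArg q (prod_gen_sq n)
  rw [map_list_prod, List.map_ofFn, List.prod_ofFn, map_one] at h
  simp only [Function.comp_apply, map_pow, Finset.prod_pow] at h
  have h2 : (2 : ℤ) • ∑ i : Fin n, genClass c i = 0 := by
    have := congrArg Multiplicative.toAdd h
    rw [toAdd_pow, toAdd_prod, toAdd_one] at this
    rw [ofNat_zsmul]
    exact this
  exact (smul_eq_zero.1 h2).resolve_left two_ne_zero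

theorem nilpotentClass_gen (c : ℕ) {n : ℕ} (i : Fin n) :
    nilpotentClass c n (Additive.ofMul (gen i)) = genClass c i :=
  rfl

theorem torsionFreeAbelianizationEnd_nilpotentQuotientCongr_trans (c : ℕ) {n : ℕ}
    (φ ψ : NonorientableSurfaceGroup n ≃* NonorientableSurfaceGroup n) :
    torsionFreeAbelianizationEnd (nilpotentQuotientCongr c (φ.trans ψ)).toMonoidHom =
      torsionFreeAbelianizationEnd (nilpotentQuotientCongr c ψ).toMonoidHom ∘ₗ
        torsionFreeAbelianizationEnd (nilpotentQuotientCongr c φ).toMonoidHom :=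
  torsionFreeAbelianization_hom_ext (closure_range_mk_gen c n) (by rintro _ ⟨i, rfl⟩; rfl)

theorem hom_ext_genClass {c n : ℕ} {M : Type*} [AddCommGroup M]
    {f f' : TorsionFreeAbelianization (NilpotentQuotient (NonorientableSurfaceGroup n) c) →ₗ[ℤ] M}
    (h : ∀ i, f (genClass c i) = f' (genClass c i)) : f = f' :=
  torsionFreeAbelianization_hom_ext (closure_range_mk_gen c n) (by rintro _ ⟨i, rfl⟩; exact h i)

/-- Either sign is the action on the torsion-free abelianization of an automorphism of the surface
group. -/
theorem exists_sign_automorphism (n k : ℕ) :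
    ∃ σ : NonorientableSurfaceGroup n ≃* NonorientableSurfaceGroup n, ∀ (c : ℕ) (i : Fin n),
      nilpotentClass c n (Additive.ofMul (σ (gen i))) = (-1 : ℤ) ^ k • genClass c i := by
  rcases Nat.even_or_odd k with hk | hk
  · exact ⟨MulEquiv.refl _, fun c i => by simp [hk.neg_one_pow, nilpotentClass_gen]⟩
  · refine ⟨reflection n, fun c i => ?_⟩
    have : reflection n (gen i) = _ := reflectionHom_gen i
    rw [this, hk.neg_one_pow]
    simp only [ofMul_mul, ofMul_inv, map_add, map_neg, nilpotentClass_gen]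
    simp

/-! ### The torsion-free abelianization as a ring -/

/-- The images of the generators under the identification of the torsion-free abelianization with
`ℤ[u]`: the last generator is sent to `1`, each previous one to the next power of `u`, and the
first to `-u ^ (m + 1)`. -/
def rootFamily {M : Type*} [CommRing M] (m : ℕ) (u : M) : Fin (m + 2) → M :=
  Fin.cons (-u ^ (m + 1)) fun i : Fin (m + 1) => u ^ (i.rev : ℕ)

theorem sum_rootFamily {M : Type*} [CommRing M] {m : ℕ} {u : M}
    (hu : u ^ (m + 1) = ∑ k ∈ Finset.range (m + 1), u ^ k) :
    ∑ i, rootFamily m u i = 0 := by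
  simp only [rootFamily, Fin.sum_univ_succ (n := m + 1), Fin.cons_zero, Fin.cons_succ]
  have h := Equiv.sum_comp Fin.revPerm fun i : Fin (m + 1) => u ^ (i : ℕ)
  simp only [Fin.revPerm_apply] at h
  rw [hu, h, Fin.sum_univ_eq_sum_range (fun k => u ^ k), neg_add_cancel]

theorem rootFamily_zero {M : Type*} [CommRing M] (m : ℕ) (u : M) :
    rootFamily m u 0 = -u ^ (m + 1) :=
  rfl

theorem rootFamily_succ {M : Type*} [CommRing M] (m : ℕ) (u : M) (i : Fin (m + 1)) :
    rootFamily m u i.succ = u ^ (i.rev : ℕ) :=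
  rfl

/-- If the powers of `t = ±u` form a basis of a ring `M`, and `u` is a root of the multinacci
polynomial, then `rootFamily` identifies the torsion-free abelianization with `M`. The sign is
carried by `s`, so that the basis and the relation may use different elements. -/
theorem exists_linearEquiv_rootFamily {c : ℕ} (hc : 0 < c) {m : ℕ} {M : Type*} [CommRing M]
    [Module.IsTorsionFree ℤ M] {s : ℤ} (hs : s * s = 1) {t : M}
    (b : Module.Basis (Fin (m + 1)) ℤ M) (hb : ∀ k, b k = t ^ (k : ℕ))
    (hu : (s • t) ^ (m + 1) = ∑ k ∈ Finset.range (m + 1), (s • t) ^ k) :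
    ∃ E : TorsionFreeAbelianization (NilpotentQuotient (NonorientableSurfaceGroup (m + 2)) c)
      ≃ₗ[ℤ] M, ∀ i, E (genClass c i) = rootFamily m (s • t) i := by
  let F : NonorientableSurfaceGroup (m + 2) →* Multiplicative M :=
    lift (fun i => Multiplicative.ofAdd (rootFamily m (s • t) i)) (by
      rw [List.prod_ofFn, Finset.prod_pow, ← ofAdd_sum, sum_rootFamily hu, ofAdd_zero, one_pow])
  let f := torsionFreeLift (nilpotentQuotientLift hc F)
  have hf : ∀ i, f (genClass c i) = rootFamily m (s • t) i := fun i =>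
    congrArg Multiplicative.toAdd (lift_gen _ _ i : F (gen i) = _)
  -- The inverse is forced on the basis: with `u = s • t`, `t ^ k` is `s ^ k` times the
  -- image `u ^ k` of a generator.
  let f' : M →ₗ[ℤ] _ := b.constr ℤ fun k => s ^ (k : ℕ) • genClass c k.rev.succ
  have hf' : ∀ k, f' (b k) = s ^ (k : ℕ) • genClass c k.rev.succ := b.constr_basis ℤ _
  have hss : ∀ k : ℕ, s ^ k * s ^ k = 1 := fun k => by rw [← mul_pow, hs, one_pow]
  have hpow : ∀ k : Fin (m + 1), (s • t) ^ (k : ℕ) = s ^ (k : ℕ) • b k := fun k => by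
    rw [hb, _root_.smul_pow]
  have hsucc : ∀ i : Fin (m + 1), f' (rootFamily m (s • t) i.succ) = genClass c i.succ := by
    intro i
    rw [rootFamily_succ, hpow, map_smul, hf', smul_smul, hss, one_smul, Fin.rev_rev]
  refine ⟨LinearEquiv.ofLinearMap f f' (b.ext fun k => ?_) (hom_ext_genClass fun i => ?_), hf⟩
  · rw [LinearMap.comp_apply, hf', map_smul, hf, rootFamily_succ, Fin.rev_rev, hpow, smul_smul,
      hss, one_smul, LinearMap.id_apply]
  · rw [LinearMap.comp_apply, hf, LinearMap.id_apply]
    cases i using Fin.cases with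
    | succ i => exact hsucc i
    | zero =>
      -- Both families sum to zero, so the values at the other generators determine this one.
      have h1 := congrArg f' (sum_rootFamily hu)
      have h2 := sum_genClass c (m + 2)
      rw [Fin.sum_univ_succ] at h1 h2
      rw [map_add, map_sum, map_zero] at h1
      simp only [hsucc] at h1
      exact add_right_cancel (h1.trans h2.symm)

/-- Under the identification of the generators with `rootFamily`, the automorphism `slide` is
multiplication by `u`. -/
theorem map_slide_eq_mul {c m : ℕ} {M : Type*} [CommRing M] {u : M}
    (hu : u ^ (m + 1) = ∑ k ∈ Finset.range (m + 1), u ^ k)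
    (E : TorsionFreeAbelianization (NilpotentQuotient (NonorientableSurfaceGroup (m + 2)) c)
      →ₗ[ℤ] M) (hE : ∀ i, E (genClass c i) = rootFamily m u i) (i : Fin (m + 2)) :
    E (nilpotentClass c _ (Additive.ofMul (slide m (gen i)))) = u * E (genClass c i) := by
  have hlast : rootFamily m u (Fin.last (m + 1)) = 1 := by
    rw [← Fin.succ_last, rootFamily_succ]; simp
  change E (nilpotentClass c _ (Additive.ofMul (slideHom m (gen i)))) = _
  cases i using Fin.cases with
  | zero =>
    rw [slideHom_gen_zero]
    simp only [ofMul_mul, ofMul_inv, ofMul_pow, map_add, map_neg, map_nsmul, nilpotentClass_gen,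
      hE, hlast, rootFamily_zero]
    linear_combination -pow_mul_two_sub_eq_one hu
  | succ i =>
    cases i using Fin.cases with
    | zero =>
      rw [Fin.succ_zero_eq_one, slideHom_gen_one, ← Fin.succ_zero_eq_one]
      simp only [ofMul_mul, ofMul_inv, map_add, map_neg, nilpotentClass_gen, hE, hlast,
        rootFamily_zero, rootFamily_succ, Fin.rev_zero, Fin.val_last]
      ring
    | succ i =>
      rw [slideHom_gen_succ_succ, nilpotentClass_gen, hE, hE, ← Fin.succ_castSucc,
        rootFamily_succ, rootFamily_succ, Fin.rev_castSucc, Fin.rev_succ, Fin.val_succ,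
        Fin.val_castSucc, pow_succ']

/-- For either sign `s`, an automorphism realizes as characteristic polynomial the polynomial
whose roots are `s` times those of the multinacci polynomial. -/
theorem exists_automorphism_charpoly {c : ℕ} (hc : 0 < c) (m k : ℕ) :
    ∃ φ : NilpotentQuotient (NonorientableSurfaceGroup (m + 2)) c ≃*
        NilpotentQuotient (NonorientableSurfaceGroup (m + 2)) c,
      LinearMap.det (torsionFreeAbelianizationEnd φ.toMonoidHom) =
        (-1) ^ (m + 1) * ((multinacci (m + 1)).scaleRoots ((-1) ^ k)).coeff 0 ∧
      (torsionFreeAbelianizationEnd φ.toMonoidHom).charpoly =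
        (multinacci (m + 1)).scaleRoots ((-1) ^ k) := by
  set s : ℤ := (-1) ^ k with hs_def
  have hs : s * s = 1 := by rw [hs_def, ← mul_pow]; simp
  set q := (multinacci (m + 1)).scaleRoots s
  have hq : q.Monic := (monic_scaleRoots_iff s).2 (monic_multinacci _)
  have hdeg : q.natDegree = m + 1 := by rw [natDegree_scaleRoots, natDegree_multinacci]
  -- `t` is a root of `q`, and `s • t` one of the multinacci polynomial; `slide` will act as `s • t`
  -- and the sign automorphism as `s`, hence their composite as `t`.
  set t := AdjoinRoot.root q
  let b := (AdjoinRoot.powerBasis' hq).basis.reindex (finCongr hdeg)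
  have hb : ∀ k, b k = t ^ (k : ℕ) := fun k => by
    simp only [b, Module.Basis.reindex_apply, PowerBasis.coe_basis]
    rfl
  have : Module.Free ℤ (AdjoinRoot q) := Module.Free.of_basis b
  have : Module.Finite ℤ (AdjoinRoot q) := Module.Finite.of_basis b
  have hu : (s • t) ^ (m + 1) = ∑ k ∈ Finset.range (m + 1), (s • t) ^ k := by
    have h := scaleRoots_aeval_eq_zero (r := s) ((AdjoinRoot.aeval_eq q).trans AdjoinRoot.mk_self)
    have hqs : q.scaleRoots s = multinacci (m + 1) := by
      rw [← scaleRoots_mul, hs, scaleRoots_one]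
    rw [hqs, ← Algebra.smul_def, aeval_multinacci] at h
    exact sub_eq_zero.1 h
  obtain ⟨E, hE⟩ := exists_linearEquiv_rootFamily hc hs b hb hu
  obtain ⟨σ, hσ⟩ := exists_sign_automorphism (m + 2) k
  let φ := nilpotentQuotientCongr c ((slide m).trans σ)
  have hconj : E.conj (torsionFreeAbelianizationEnd φ.toMonoidHom) = Algebra.lmul ℤ _ t := by
    have h1 : torsionFreeAbelianizationEnd (nilpotentQuotientCongr c σ).toMonoidHom =
        s • LinearMap.id := hom_ext_genClass fun i => hσ c i
    have h2 : E.toLinearMap ∘ₗ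
        torsionFreeAbelianizationEnd (nilpotentQuotientCongr c (slide m)).toMonoidHom =
          Algebra.lmul ℤ _ (s • t) ∘ₗ E.toLinearMap :=
      hom_ext_genClass fun i => map_slide_eq_mul hu E.toLinearMap hE i
    ext x
    obtain ⟨y, rfl⟩ := E.surjective x
    have h3 := LinearMap.congr_fun h2 y
    simp only [LinearMap.comp_apply, LinearEquiv.coe_coe] at h3
    rw [LinearEquiv.conj_apply_apply, E.symm_apply_apply,
      torsionFreeAbelianizationEnd_nilpotentQuotientCongr_trans, LinearMap.comp_apply, h1,
      LinearMap.smul_apply, LinearMap.id_apply, map_smul, h3]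
    change s • (s • t * E y) = t * E y
    rw [smul_mul_assoc, smul_smul, hs, one_smul]
  have hchar : (Algebra.lmul ℤ (AdjoinRoot q) t).charpoly = q := charpoly_lmul_root hq
  refine ⟨φ, ?_, ?_⟩
  · rw [← LinearMap.det_conj _ E]
    change LinearMap.det (E.conj (torsionFreeAbelianizationEnd φ.toMonoidHom)) = _
    rw [hconj, LinearMap.det_eq_sign_charpoly_coeff, hchar,
      (AdjoinRoot.powerBasis' hq).finrank, AdjoinRoot.powerBasis'_dim, hdeg]
  · rw [← LinearEquiv.charpoly_conj E, hconj, hchar]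

end NonorientableSurfaceGroup

theorem mainTheorem5 (c g : ℕ) (hc : 0 < c) (hg : 1 < g) :
    ∃ φ : NilpotentQuotient (NonorientableSurfaceGroup (g + 1)) c ≃*
        NilpotentQuotient (NonorientableSurfaceGroup (g + 1)) c,
      LinearMap.det (torsionFreeAbelianizationEnd φ.toMonoidHom) = -1 ∧
      ∃ r : ℝ, 1 < |r| ∧
        ((torsionFreeAbelianizationEnd φ.toMonoidHom).charpoly.map
          (Int.castRingHom ℂ)).rootMultiplicity (r : ℂ) = 1 ∧
        ∀ z : ℂ, ((torsionFreeAbelianizationEnd φ.toMonoidHom).charpoly.map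
          (Int.castRingHom ℂ)).IsRoot z → z ≠ (r : ℂ) → ‖z‖ < 1 := by
  obtain ⟨m, rfl⟩ : ∃ m, g = m + 1 := ⟨g - 1, by lia⟩
  -- The sign `(-1) ^ g` makes the determinant equal to `-1` for both parities of `g`.
  obtain ⟨φ, hdet, hchar⟩ :=
    NonorientableSurfaceGroup.exists_automorphism_charpoly hc m (m + 1)
  refine ⟨φ, hdet.trans (neg_one_pow_mul_coeff_zero_scaleRoots_multinacci m.succ_ne_zero), ?_⟩
  rw [hchar]
  exact exists_dominant_root_scaleRoots_multinacci hg (m + 1)
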